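/- Conventions. A *polyhedron* in a finite-dimensional real vector space $V$ is an intersection of finitely many closed halfspaces. A *face* of a polyhedron $\Lambda\subset V$ is a non-empty set of the form $\{u\in\Lambda : \langle x,u\rangle\le\langle x,v\rangle \text{ for all } v\in\Lambda\}$ with $x\in V^\vee$. A *polyhedral complex* in $V$ is a non-empty finite collection $\Pi$ of non-empty polyhedra of $V$ such that every face of an element of $\Pi$ is in $\Pi$, and any two elements of $\Pi$ are either disjoint or intersect in a common face. Its support is $|\Pi|=\bigcup_{\Lambda\in\Pi}\Lambda$, and $\Pi$ is *complete* if $|\Pi|=V$. A *subdivision* of $\Pi$ is a polyhedral complex $\Pi'$ with $|\Pi'|=|\Pi|$ such that every element of $\Pi'$ is contained in an element of $\Pi$. A polyhedral complex is *extendable* if it is a subcomplex of (that is, contained in) a complete polyhedral complex. For a polyhedron $\Lambda$ in $\mathbb{R}^n$ put $$\operatorname{rec}(\Lambda)=\bigcap_{p\in\Lambda}\{u\in\mathbb{R}^n : p+\lambda u\in\Lambda \text{ for all } \lambda\ge 0\},\qquad \operatorname{c}(\Lambda)=\overline{\mathbb{R}_{>0}(\Lambda\times\{1\})}\subset\mathbb{R}^n\times\mathbb{R},$$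 and for a polyhedral complex $\Pi$ in $\mathbb{R}^n$ put $\operatorname{rec}(\Pi)=\{\operatorname{rec}(\Lambda) : \Lambda\in\Pi\}$ and $\operatorname{c}(\Pi)=\{\operatorname{c}(\Lambda) : \Lambda\in\Pi\}\cup\{\sigma\times\{0\} : \sigma\in\operatorname{rec}(\Pi)\}$. **Proposition.** Let $\Pi$ be a polyhedral complex in $\mathbb{R}^n$. Then there exists a subdivision $\Pi'$ of $\Pi$ that is extendable. In particular, for this $\Pi'$, $\operatorname{rec}(\Pi')$ is a polyhedral complex in $\mathbb{R}^n$ and $\operatorname{c}(\Pi')$ is a polyhedral complex in $\mathbb{R}^n\times\mathbb{R}$. -/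

import Mathlib

namespace PolyComplex

section Linear

variable {V : Type*} [AddCommGroup V] [Module ℝ V]

/-- A polyhedron: an intersection of finitely many closed halfspaces `{u | f u ≤ b}`. -/
def IsPolyhedron (P : Set V) : Prop :=
  ∃ H : Set (Module.Dual ℝ V × ℝ), H.Finite ∧ P = {u | ∀ h ∈ H, h.1 u ≤ h.2}

/-- The set `P_x` of points of `P` at which the linear form `x` attains its minimum on `P`. -/
def minLocus (P : Set V) (x : Module.Dual ℝ V) : Set V :=
  {u | u ∈ P ∧ ∀ v ∈ P, x u ≤ x v}

/-- A face of `P`: a nonempty set of the form `P_x` for a linear form `x`. -/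
def IsFace (F P : Set V) : Prop :=
  F.Nonempty ∧ ∃ x : Module.Dual ℝ V, F = minLocus P x

/-- A polyhedral complex: a nonempty finite collection of nonempty polyhedra that contains the faces
of its elements and in which any two elements are disjoint or intersect in a common face. -/
structure IsPolyhedralComplex (S : Set (Set V)) : Prop where
  nonempty : S.Nonempty
  finite : S.Finite
  isPolyhedron : ∀ P ∈ S, IsPolyhedron P
  nonempty_of_mem : ∀ P ∈ S, P.Nonempty
  face_mem : ∀ P ∈ S, ∀ F, IsFace F P → F ∈ S
  inter : ∀ P ∈ S, ∀ Q ∈ S, Disjoint P Q ∨ (IsFace (P ∩ Q) P ∧ IsFace (P ∩ Q) Q)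

/-- The support of a collection of sets: their union. -/
def support (S : Set (Set V)) : Set V := ⋃₀ S

/-- `S'` is a subdivision of the polyhedral complex `S`: a polyhedral complex with the same support
each of whose elements is contained in an element of `S`. -/
structure IsSubdivision (S' S : Set (Set V)) : Prop where
  isPolyhedralComplex : IsPolyhedralComplex S'
  support_eq : support S' = support S
  subset : ∀ P' ∈ S', ∃ P ∈ S, P' ⊆ P

/-- A polyhedral complex is extendable if it is a subcomplex of a complete polyhedral complex,
that is, of one whose support is the whole space. -/
def IsExtendable (S : Set (Set V)) : Prop :=
  IsPolyhedralComplex S ∧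
    ∃ T : Set (Set V), IsPolyhedralComplex T ∧ support T = Set.univ ∧ S ⊆ T

/-- The local recession cone `rec_p(E)`. -/
def localRec (E : Set V) (p : V) : Set V :=
  {u | ∀ t : ℝ, 0 ≤ t → p + t • u ∈ E}

/-- The recession cone `rec(E)`. -/
def recCone (E : Set V) : Set V := ⋂ p ∈ E, localRec E p

/-- The recession `rec(S)` of a collection of polyhedra. -/
def recession (S : Set (Set V)) : Set (Set V) := {σ | ∃ P ∈ S, σ = recCone P}

end Linear

section Topological

variable {V : Type*} [AddCommGroup V] [Module ℝ V] [TopologicalSpace V]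

/-- The cone `c(E)`: the closure of `ℝ_{>0} (E × {1})` in `V × ℝ`. -/
def coneOver (E : Set V) : Set (V × ℝ) :=
  closure {z | ∃ t : ℝ, 0 < t ∧ ∃ u ∈ E, z = t • (u, (1 : ℝ))}

/-- The cone `c(S)` of a collection of polyhedra: the cones `c(P)` for `P` in `S`, together with the
sets `σ × {0}` for `σ` in `rec(S)`. -/
def coneComplex (S : Set (Set V)) : Set (Set (V × ℝ)) :=
  {C | ∃ P ∈ S, C = coneOver P} ∪ {C | ∃ σ ∈ recession S, C = σ ×ˢ ({0} : Set ℝ)}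

end Topological

end PolyComplex

/-! All the halfspaces bounding the elements of `S` give one finite affine hyperplane arrangement
`H`. Its closed cells form a complete complex, and each element of `S` is a union of cells, so the
cells at points of the support form an extendable subdivision.

The other two claims are proved from the arrangement as well. Recession cones of cells are cells of
the parallel linear arrangement, and the cones `c` of cells, like the sets `rec × {0}`, are cells of
the homogenized arrangement in `V × ℝ`. Both families thus sit inside a complete complex, and by
`IsPolyhedralComplex.mono` only closure under faces is left. The key is `exists_recCone_eq_cell`: a
face of the recession cone of a cell is the recession cone of a face of that cell. -/

namespace PolyComplex

open Filter Topology

section Arrangement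

variable {V : Type*} [AddCommGroup V] [Module ℝ V]

/-- A subset of a polyhedral complex that is closed under faces is a polyhedral complex. -/
theorem IsPolyhedralComplex.mono {S T : Set (Set V)} (hT : IsPolyhedralComplex T) (hST : S ⊆ T)
    (hne : S.Nonempty) (hface : ∀ P ∈ S, ∀ F, IsFace F P → F ∈ S) : IsPolyhedralComplex S where
  nonempty := hne
  finite := hT.finite.subset hST
  isPolyhedron P hP := hT.isPolyhedron P (hST hP)
  nonempty_of_mem P hP := hT.nonempty_of_mem P (hST hP)
  face_mem := hface
  inter P hP Q hQ := hT.inter P (hST hP) Q (hST hQ)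

/-! ### Cells of an affine arrangement -/

/-- The closed cell of the hyperplane arrangement `{f = b}`, `(f, b) ∈ H`, whose relative interior
contains `v`. -/
def cell (H : Set (Module.Dual ℝ V × ℝ)) (v : V) : Set V :=
  {u | ∀ h ∈ H, (h.1 v ≤ h.2 → h.1 u ≤ h.2) ∧ (h.2 ≤ h.1 v → h.2 ≤ h.1 u)}

variable {H : Set (Module.Dual ℝ V × ℝ)}

theorem self_mem_cell (v : V) : v ∈ cell H v := fun _ _ => ⟨id, id⟩

theorem cell_subset_of_mem {u v : V} (h : u ∈ cell H v) : cell H u ⊆ cell H v :=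
  fun _ hz k hk => ⟨fun a => (hz k hk).1 ((h k hk).1 a), fun a => (hz k hk).2 ((h k hk).2 a)⟩

/-- A cell depends only on the two subsets of `H` that record on which closed sides `v` lies. -/
theorem finite_range_cell (hH : H.Finite) : (Set.range (cell H)).Finite := by
  let g : Set (Module.Dual ℝ V × ℝ) × Set (Module.Dual ℝ V × ℝ) → Set V := fun A =>
    {u | (∀ h ∈ A.1, h.1 u ≤ h.2) ∧ ∀ h ∈ A.2, h.2 ≤ h.1 u}
  refine ((hH.finite_subsets.prod hH.finite_subsets).image g).subset ?_
  rintro _ ⟨v, rfl⟩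
  refine ⟨({h ∈ H | h.1 v ≤ h.2}, {h ∈ H | h.2 ≤ h.1 v}),
    ⟨Set.sep_subset _ _, Set.sep_subset _ _⟩, ?_⟩
  ext u
  simp only [g, cell, Set.mem_ofPred_eq, and_imp]
  exact ⟨fun h k hk => ⟨h.1 k hk, h.2 k hk⟩, fun h => ⟨fun k hk => (h k hk).1, fun k hk => (h k hk).2⟩⟩

theorem isPolyhedron_cell (hH : H.Finite) (v : V) : IsPolyhedron (cell H v) := by
  refine ⟨{h ∈ H | h.1 v ≤ h.2} ∪ (fun h => (-h.1, -h.2)) '' {h ∈ H | h.2 ≤ h.1 v},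
    (hH.subset (Set.sep_subset _ _)).union ((hH.subset (Set.sep_subset _ _)).image _), ?_⟩
  ext u
  constructor
  · rintro h _ (⟨hk, hv⟩ | ⟨k, ⟨hk, hv⟩, rfl⟩)
    · exact (h _ hk).1 hv
    · simpa using (h _ hk).2 hv
  · intro h k hk
    refine ⟨fun hv => h k (Or.inl ⟨hk, hv⟩), fun hv => ?_⟩
    simpa using h _ (Or.inr ⟨k, ⟨hk, hv⟩, rfl⟩)

theorem convex_cell (v : V) : Convex ℝ (cell H v) := by
  intro x hx y hy a b ha hb hab k hk
  simp only [map_add, map_smul, smul_eq_mul]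
  have e : k.2 = a * k.2 + b * k.2 := by rw [← add_mul, hab, one_mul]
  refine ⟨fun hv => ?_, fun hv => ?_⟩
  · rw [e]
    exact add_le_add (mul_le_mul_of_nonneg_left ((hx k hk).1 hv) ha)
      (mul_le_mul_of_nonneg_left ((hy k hk).1 hv) hb)
  · rw [e]
    exact add_le_add (mul_le_mul_of_nonneg_left ((hx k hk).2 hv) ha)
      (mul_le_mul_of_nonneg_left ((hy k hk).2 hv) hb)

/-- A convex set that lies on one side of every hyperplane has a point that is generic. -/
theorem exists_subset_cell (hH : H.Finite) {C : Set V} (hC : Convex ℝ C) (hne : C.Nonempty)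
    (hside : ∀ h ∈ H, (∀ u ∈ C, h.1 u ≤ h.2) ∨ ∀ u ∈ C, h.2 ≤ h.1 u) :
    ∃ z ∈ C, C ⊆ cell H z := by
  obtain ⟨_, ⟨z, hz, rfl⟩, hmax⟩ :=
    ((finite_range_cell hH).subset (Set.image_subset_range (cell H) C)).exists_maximal
      (hne.image _)
  refine ⟨z, hz, fun u hu => ?_⟩
  -- Since `C` crosses no hyperplane, the cell of the midpoint contains both ends. Maximality of the
  -- cell of `z` then puts `u` in it.
  have hm : (1 / 2 : ℝ) • z + (1 / 2 : ℝ) • u ∈ C :=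
    hC hz hu (by norm_num) (by norm_num) (by norm_num)
  have key : z ∈ cell H ((1 / 2 : ℝ) • z + (1 / 2 : ℝ) • u) ∧
      u ∈ cell H ((1 / 2 : ℝ) • z + (1 / 2 : ℝ) • u) := by
    refine ⟨fun k hk => ?_, fun k hk => ?_⟩ <;>
    · simp only [map_add, map_smul, smul_eq_mul]
      rcases hside k hk with h | h <;>
      · have := h z hz
        have := h u hu
        constructor <;> intro <;> linarith
  exact hmax (Set.mem_image_of_mem _ hm) (cell_subset_of_mem key.1) key.2

theorem convex_minLocus {P : Set V} (hP : Convex ℝ P) (x : Module.Dual ℝ V) :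
    Convex ℝ (minLocus P x) := by
  intro u hu v hv a b ha hb hab
  refine ⟨hP hu.1 hv.1 ha hb hab, fun w hw => ?_⟩
  simp only [map_add, map_smul, smul_eq_mul]
  calc a * x u + b * x v ≤ a * x w + b * x w :=
        add_le_add (mul_le_mul_of_nonneg_left (hu.2 w hw) ha)
          (mul_le_mul_of_nonneg_left (hv.2 w hw) hb)
    _ = x w := by rw [← add_mul, hab, one_mul]

/-- Hyperplanes through `z` also contain `u`, and the others leave room around `z`; so `z` is in the
relative interior of its cell. -/
theorem exists_extend_mem_cell (hH : H.Finite) {u z : V} (hu : u ∈ cell H z) :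
    ∃ ε : ℝ, 0 < ε ∧ z + ε • (z - u) ∈ cell H z := by
  have hev : ∀ᶠ ε : ℝ in 𝓝[>] 0, z + ε • (z - u) ∈ cell H z := by
    refine (eventually_all_finite hH).2 fun h hh => ?_
    simp only [map_add, map_smul, map_sub, smul_eq_mul]
    have hlim : Tendsto (fun ε : ℝ => h.1 z + ε * (h.1 z - h.1 u)) (𝓝[>] 0) (𝓝 (h.1 z)) := by
      refine Tendsto.mono_left ?_ nhdsWithin_le_nhds
      have : Continuous fun ε : ℝ => h.1 z + ε * (h.1 z - h.1 u) := by fun_prop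
      simpa using this.tendsto 0
    rcases lt_trichotomy (h.1 z) h.2 with hlt | heq | hgt
    · filter_upwards [hlim.eventually_lt_const hlt] with ε hε
      exact ⟨fun _ => hε.le, fun h' => absurd h' hlt.not_ge⟩
    · have : h.1 u = h.2 := le_antisymm ((hu h hh).1 heq.le) ((hu h hh).2 heq.ge)
      simp [this, heq]
    · filter_upwards [hlim.eventually_const_lt hgt] with ε hε
      exact ⟨fun h' => absurd h' hgt.not_ge, fun _ => hε.le⟩
  obtain ⟨ε, h1, h2⟩ := (hev.and self_mem_nhdsWithin).exists
  exact ⟨ε, h2, h1⟩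

/-- Take `z` generic in the face. A segment from a point `u` of its cell can be prolonged beyond
`z`, so a form minimal at `z` cannot be larger at `u`. -/
theorem IsFace.exists_eq_cell (hH : H.Finite) {F : Set V} {v : V} (hF : IsFace F (cell H v)) :
    ∃ z ∈ cell H v, F = cell H z := by
  obtain ⟨hne, x, rfl⟩ := hF
  obtain ⟨z, hz, hsub⟩ := exists_subset_cell hH (convex_minLocus (convex_cell v) x) hne
    fun h hh => (le_total (h.1 v) h.2).imp (fun hv u hu => (hu.1 h hh).1 hv)
      (fun hv u hu => (hu.1 h hh).2 hv)
  refine ⟨z, hz.1, hsub.antisymm fun u hu => ⟨cell_subset_of_mem hz.1 hu, fun w hw => ?_⟩⟩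
  obtain ⟨ε, hε, hmem⟩ := exists_extend_mem_cell hH hu
  have h1 := hz.2 _ (cell_subset_of_mem hz.1 hmem)
  simp only [map_add, map_smul, map_sub, smul_eq_mul] at h1
  have h2 : 0 ≤ x z - x u := nonneg_of_mul_nonneg_right (by linarith) hε
  linarith [hz.2 w hw]

/-- The supporting form sums the forms of the hyperplanes through `z`, signed so that each is
bounded below on the cell of `v` by its value on the hyperplane. The sum is minimal exactly where
every term is. -/
theorem isFace_cell (hH : H.Finite) {z v : V} (hz : z ∈ cell H v) :
    IsFace (cell H z) (cell H v) := by
  classical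
  let K := hH.toFinset.filter fun h => h.1 z = h.2
  let s : Module.Dual ℝ V × ℝ → ℝ := fun h => SignType.sign (h.1 v - h.2)
  have hs : ∀ h ∈ K, ∀ u ∈ cell H v, 0 ≤ s h * (h.1 u - h.2) := by
    intro h hh u hu
    have hh' : h ∈ H := by simpa using (Finset.mem_filter.1 hh).1
    rcases lt_trichotomy (h.1 v) h.2 with h1 | h1 | h1
    · have := (hu h hh').1 h1.le
      simp only [s, sign_neg (sub_neg.2 h1)]
      simpa using this
    · simp [s, h1]
    · have := (hu h hh').2 h1.le
      simp only [s, sign_pos (sub_pos.2 h1)]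
      simpa using this
  let x : Module.Dual ℝ V := ∑ h ∈ K, s h • h.1
  have hx : ∀ u, x u = ∑ h ∈ K, s h * (h.1 u - h.2) + ∑ h ∈ K, s h * h.2 := by
    intro u
    simp [x, mul_sub]
  have hxz : ∀ u ∈ cell H z, ∑ h ∈ K, s h * (h.1 u - h.2) = 0 := by
    refine fun u hu => Finset.sum_eq_zero fun h hh => ?_
    obtain ⟨hh1, hh2⟩ := Finset.mem_filter.1 hh
    have hh' : h ∈ H := by simpa using hh1
    have : h.1 u = h.2 := le_antisymm ((hu h hh').1 hh2.le) ((hu h hh').2 hh2.ge)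
    simp [this]
  refine ⟨⟨z, self_mem_cell z⟩, x, ?_⟩
  ext u
  constructor
  · refine fun hu => ⟨cell_subset_of_mem hz hu, fun w hw => ?_⟩
    rw [hx, hx, hxz u hu]
    linarith [Finset.sum_nonneg fun h hh => hs h hh w hw]
  · rintro ⟨huv, hu⟩
    have h1 := hu z hz
    rw [hx, hx, hxz z (self_mem_cell z)] at h1
    have h0 := (Finset.sum_eq_zero_iff_of_nonneg fun h hh => hs h hh u huv).1
      (le_antisymm (by linarith) (Finset.sum_nonneg fun h hh => hs h hh u huv))
    intro h hh
    by_cases hzero : h.1 z = h.2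
    · have := h0 h (Finset.mem_filter.2 ⟨by simpa using hh, hzero⟩)
      rcases mul_eq_zero.1 this with h2 | h2
      -- A zero sign means that the hyperplane contains `v`, hence the whole cell of `v`.
      · have h3 : h.1 v = h.2 := by
          have : SignType.sign (h.1 v - h.2) = 0 := by
            rcases h4 : SignType.sign (h.1 v - h.2) <;> simp_all [s]
          linarith [sign_eq_zero_iff.1 this]
        exact ⟨fun _ => (huv h hh).1 h3.le, fun _ => (huv h hh).2 h3.ge⟩
      · constructor <;> intro <;> linarith
    · rcases lt_or_gt_of_ne hzero with h2 | h2
      · refine ⟨fun _ => (huv h hh).1 ?_, fun h3 => absurd h3 h2.not_ge⟩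
        by_contra h4
        exact h2.not_ge ((hz h hh).2 (not_le.1 h4).le)
      · refine ⟨fun h3 => absurd h3 h2.not_ge, fun _ => (huv h hh).2 ?_⟩
        by_contra h4
        exact h2.not_ge ((hz h hh).1 (not_le.1 h4).le)

theorem exists_inter_eq_cell (hH : H.Finite) {v w : V} (hne : (cell H v ∩ cell H w).Nonempty) :
    ∃ z ∈ cell H v ∩ cell H w, cell H v ∩ cell H w = cell H z := by
  obtain ⟨z, hz, hsub⟩ := exists_subset_cell hH ((convex_cell v).inter (convex_cell w)) hne
    fun h hh => (le_total (h.1 v) h.2).imp (fun hv u hu => (hu.1 h hh).1 hv)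
      (fun hv u hu => (hu.1 h hh).2 hv)
  exact ⟨z, hz, hsub.antisymm
    (Set.subset_inter (cell_subset_of_mem hz.1) (cell_subset_of_mem hz.2))⟩

theorem isPolyhedralComplex_range_cell (hH : H.Finite) :
    IsPolyhedralComplex (Set.range (cell H)) where
  nonempty := Set.range_nonempty _
  finite := finite_range_cell hH
  isPolyhedron := by
    rintro _ ⟨v, rfl⟩
    exact isPolyhedron_cell hH v
  nonempty_of_mem := by
    rintro _ ⟨v, rfl⟩
    exact ⟨v, self_mem_cell v⟩
  face_mem := by
    rintro _ ⟨v, rfl⟩ F hF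
    obtain ⟨z, -, rfl⟩ := hF.exists_eq_cell hH
    exact ⟨z, rfl⟩
  inter := by
    rintro _ ⟨v, rfl⟩ _ ⟨w, rfl⟩
    rcases (cell H v ∩ cell H w).eq_empty_or_nonempty with h | h
    · exact Or.inl (Set.disjoint_iff_inter_eq_empty.2 h)
    · obtain ⟨z, hz, heq⟩ := exists_inter_eq_cell hH h
      rw [heq]
      exact Or.inr ⟨isFace_cell hH hz.1, isFace_cell hH hz.2⟩

theorem support_range_cell : support (Set.range (cell H)) = Set.univ :=
  Set.eq_univ_of_forall fun v => ⟨_, ⟨v, rfl⟩, self_mem_cell v⟩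

/-! ### Recession cones of cells -/

/-- The linear arrangement parallel to an affine one. -/
def linearPart (H : Set (Module.Dual ℝ V × ℝ)) : Set (Module.Dual ℝ V × ℝ) :=
  (fun h => (h.1, 0)) '' H

theorem mem_cell_linearPart {u w : V} : u ∈ cell (linearPart H) w ↔
    ∀ h ∈ H, (h.1 w ≤ 0 → h.1 u ≤ 0) ∧ (0 ≤ h.1 w → 0 ≤ h.1 u) := by
  simp only [cell, linearPart, Set.mem_ofPred_eq, Set.forall_mem_image]

theorem nonpos_of_forall_add_mul_le {a b c : ℝ} (h : ∀ t : ℝ, 0 ≤ t → a + t * c ≤ b) : c ≤ 0 := by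
  by_contra! hc
  have h0 := h 0 le_rfl
  have h1 := h ((b - a) / c + 1) (add_nonneg (div_nonneg (by linarith) hc.le) zero_le_one)
  rw [add_mul, div_mul_cancel₀ _ hc.ne'] at h1
  linarith

theorem mem_recCone_cell {u v : V} : u ∈ recCone (cell H v) ↔
    ∀ h ∈ H, (h.1 v ≤ h.2 → h.1 u ≤ 0) ∧ (h.2 ≤ h.1 v → 0 ≤ h.1 u) := by
  simp only [recCone, localRec, Set.mem_iInter, Set.mem_ofPred_eq]
  constructor
  · intro hu h hh
    refine ⟨fun hv => ?_, fun hv => ?_⟩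
    · refine nonpos_of_forall_add_mul_le (a := h.1 v) (b := h.2) fun t ht => ?_
      simpa using (hu v (self_mem_cell v) t ht h hh).1 hv
    · refine neg_nonpos.1 (nonpos_of_forall_add_mul_le (a := -h.1 v) (b := -h.2) fun t ht => ?_)
      have := (hu v (self_mem_cell v) t ht h hh).2 hv
      simp only [map_add, map_smul, smul_eq_mul] at this
      linarith
  · intro hu p hp t ht h hh
    simp only [map_add, map_smul, smul_eq_mul]
    refine ⟨fun hv => ?_, fun hv => ?_⟩
    · have := (hp h hh).1 hv
      have := mul_nonpos_of_nonneg_of_nonpos ht ((hu h hh).1 hv)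
      linarith
    · have := (hp h hh).2 hv
      have := mul_nonneg ht ((hu h hh).2 hv)
      linarith

theorem cell_linearPart_subset_recCone {v w : V} (hw : w ∈ recCone (cell H v)) :
    cell (linearPart H) w ⊆ recCone (cell H v) := by
  intro u hu
  rw [mem_cell_linearPart] at hu
  rw [mem_recCone_cell] at hw ⊢
  exact fun h hh => ⟨fun hv => (hu h hh).1 ((hw h hh).1 hv), fun hv => (hu h hh).2 ((hw h hh).2 hv)⟩

/-- The recession cone is convex and crosses no hyperplane of the linear arrangement, so it is the
cell of a generic point. -/
theorem exists_recCone_cell_eq (hH : H.Finite) (v : V) :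
    ∃ z ∈ recCone (cell H v), recCone (cell H v) = cell (linearPart H) z := by
  have hconv : Convex ℝ (recCone (cell H v)) := by
    intro x hx y hy a b ha hb _
    rw [mem_recCone_cell] at hx hy ⊢
    intro h hh
    simp only [map_add, map_smul, smul_eq_mul]
    refine ⟨fun hv => ?_, fun hv => ?_⟩
    · exact add_nonpos (mul_nonpos_of_nonneg_of_nonpos ha ((hx h hh).1 hv))
        (mul_nonpos_of_nonneg_of_nonpos hb ((hy h hh).1 hv))
    · exact add_nonneg (mul_nonneg ha ((hx h hh).2 hv)) (mul_nonneg hb ((hy h hh).2 hv))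
  have hside : ∀ h ∈ linearPart H, (∀ u ∈ recCone (cell H v), h.1 u ≤ h.2) ∨
      ∀ u ∈ recCone (cell H v), h.2 ≤ h.1 u := by
    rintro _ ⟨h, hh, rfl⟩
    exact (le_total (h.1 v) h.2).imp (fun hv u hu => (mem_recCone_cell.1 hu h hh).1 hv)
      (fun hv u hu => (mem_recCone_cell.1 hu h hh).2 hv)
  obtain ⟨z, hz, hsub⟩ := exists_subset_cell (hH.image _) hconv
    ⟨0, mem_recCone_cell.2 (by simp)⟩ hside
  exact ⟨z, hz, hsub.antisymm (cell_linearPart_subset_recCone hz)⟩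

/-- The descent step for `exists_recCone_eq_cell`: while some hyperplane direction contains `w` but
not the whole recession cone, a smaller cell still recedes along `w`. Move from `u` along `-y` until
a hyperplane parallel to `w` is hit, then far along `w` to stay on the right side of the hyperplanes
not parallel to `w`. -/
theorem exists_mem_cell_notMem_cell (hH : H.Finite) {u w y : V} (hw : w ∈ recCone (cell H u))
    (hy : y ∈ recCone (cell H u)) (hwy : ∃ h ∈ H, h.1 w = 0 ∧ h.1 y ≠ 0) :
    ∃ u' ∈ cell H u, w ∈ recCone (cell H u') ∧ u ∉ cell H u' := by
  rw [mem_recCone_cell] at hw hy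
  obtain ⟨k, ⟨hk, hkw, hky⟩, hmin⟩ := Set.exists_min_image {h ∈ H | h.1 w = 0 ∧ h.1 y ≠ 0}
    (fun h => (h.1 u - h.2) / h.1 y) (hH.subset (Set.sep_subset _ _))
    (hwy.imp fun h hh => ⟨hh.1, hh.2⟩)
  -- The first time at which `u - s • y` meets a hyperplane parallel to `w` but not to `y`.
  set s := (k.1 u - k.2) / k.1 y with hs
  have hne : ∀ h ∈ H, h.1 y ≠ 0 → h.1 u ≠ h.2 := fun h hh hhy heq =>
    hhy (le_antisymm ((hy h hh).1 heq.le) ((hy h hh).2 heq.ge))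
  have hev : ∀ᶠ t : ℝ in atTop, ∀ h ∈ H,
      ((h.1 u ≤ h.2 → h.1 (u - s • y + t • w) ≤ h.2) ∧
        (h.2 ≤ h.1 u → h.2 ≤ h.1 (u - s • y + t • w))) ∧
      ((h.1 (u - s • y + t • w) ≤ h.2 → h.1 w ≤ 0) ∧
        (h.2 ≤ h.1 (u - s • y + t • w) → 0 ≤ h.1 w)) := by
    refine (eventually_all_finite hH).2 fun h hh => ?_
    simp only [map_add, map_sub, map_smul, smul_eq_mul]
    rcases lt_trichotomy (h.1 w) 0 with h1 | h1 | h1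
    · have hlim : Tendsto (fun t : ℝ => h.1 u - s * h.1 y + t * h.1 w) atTop atBot :=
        tendsto_atBot_add_const_left _ _ (tendsto_id.atTop_mul_const_of_neg h1)
      filter_upwards [hlim.eventually_lt_atBot h.2] with t ht
      exact ⟨⟨fun _ => ht.le, fun h2 => absurd ((hw h hh).2 h2) h1.not_ge⟩,
        fun _ => h1.le, fun h2 => absurd h2 ht.not_ge⟩
    · refine Eventually.of_forall fun t => ⟨?_, fun _ => h1.le, fun _ => h1.ge⟩
      rw [h1, mul_zero, add_zero]
      by_cases h2 : h.1 y = 0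
      · simp [h2]
      · have h3 := hmin h ⟨hh, h1, h2⟩
        have h4 := hne h hh h2
        refine ⟨fun h5 => ?_, fun h5 => ?_⟩
        · have h6 : h.1 y < 0 := lt_of_le_of_ne ((hy h hh).1 h5) h2
          have := (le_div_iff_of_neg h6).1 h3
          linarith
        · have h6 : 0 < h.1 y := lt_of_le_of_ne ((hy h hh).2 h5) (Ne.symm h2)
          have := (le_div_iff₀ h6).1 h3
          linarith
    · have hlim : Tendsto (fun t : ℝ => h.1 u - s * h.1 y + t * h.1 w) atTop atTop :=
        tendsto_atTop_add_const_left _ _ (tendsto_id.atTop_mul_const h1)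
      filter_upwards [hlim.eventually_gt_atTop h.2] with t ht
      exact ⟨⟨fun h2 => absurd ((hw h hh).1 h2) h1.not_ge, fun _ => ht.le⟩,
        fun h2 => absurd h2 ht.not_ge, fun _ => h1.le⟩
  obtain ⟨t, ht⟩ := hev.exists
  refine ⟨u - s • y + t • w, fun h hh => (ht h hh).1,
    mem_recCone_cell.2 fun h hh => (ht h hh).2, fun hu => ?_⟩
  have hval : k.1 (u - s • y + t • w) = k.2 := by
    simp only [map_add, map_sub, map_smul, smul_eq_mul, hkw, hs, div_mul_cancel₀ _ hky]
    ring
  exact hne k hk hky (le_antisymm ((hu k hk).1 hval.le) ((hu k hk).2 hval.ge))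

/-- Every cell contained in the recession cone of a cell is itself the recession cone of a face of
that cell. -/
theorem exists_recCone_eq_cell (hH : H.Finite) {v w : V} (hw : w ∈ recCone (cell H v)) :
    ∃ u ∈ cell H v, recCone (cell H u) = cell (linearPart H) w := by
  -- Choose an inclusion-minimal cell among those of points of `cell H v` that recede along `w`. By
  -- minimality, every form of `H` vanishing at `w` vanishes on its recession cone.
  obtain ⟨_, ⟨u, ⟨huv, hwu⟩, rfl⟩, hmin⟩ :=
    ((finite_range_cell hH).subset (Set.image_subset_range (cell H)
      {u | u ∈ cell H v ∧ w ∈ recCone (cell H u)})).exists_minimal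
      (Set.Nonempty.image _ ⟨v, self_mem_cell v, hw⟩)
  refine ⟨u, huv, Set.Subset.antisymm (fun y hy => ?_) (cell_linearPart_subset_recCone hwu)⟩
  rw [mem_cell_linearPart]
  intro h hh
  have hzero : h.1 w = 0 → h.1 y = 0 := by
    intro h0
    by_contra h1
    obtain ⟨u', hu', hwu', hnot⟩ := exists_mem_cell_notMem_cell hH hwu hy ⟨h, hh, h0, h1⟩
    exact hnot (hmin (Set.mem_image_of_mem _ ⟨cell_subset_of_mem huv hu', hwu'⟩)
      (cell_subset_of_mem hu') (self_mem_cell u))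
  have hw' := mem_recCone_cell.1 hwu h hh
  have hy' := mem_recCone_cell.1 hy h hh
  rcases lt_trichotomy (h.1 w) 0 with h1 | h1 | h1
  · refine ⟨fun _ => hy'.1 ?_, fun h2 => absurd h2 h1.not_ge⟩
    by_contra h3
    exact h1.not_ge (hw'.2 (not_le.1 h3).le)
  · simp [hzero h1]
  · refine ⟨fun h2 => absurd h2 h1.not_ge, fun _ => hy'.2 ?_⟩
    by_contra h3
    exact h1.not_ge (hw'.1 (not_le.1 h3).le)

/-! ### Homogenization -/

/-- The central arrangement in `V × ℝ` that induces the given one on `V × {1}`, together with the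
hyperplane `V × {0}`. -/
def homogenization (H : Set (Module.Dual ℝ V × ℝ)) : Set (Module.Dual ℝ (V × ℝ) × ℝ) :=
  insert (LinearMap.snd ℝ V ℝ, 0)
    ((fun h => (h.1.coprod (-h.2 • LinearMap.id), 0)) '' H)

theorem finite_homogenization (hH : H.Finite) : (homogenization H).Finite :=
  (hH.image _).insert _

theorem mem_cell_homogenization {z y : V × ℝ} : z ∈ cell (homogenization H) y ↔
    ((y.2 ≤ 0 → z.2 ≤ 0) ∧ (0 ≤ y.2 → 0 ≤ z.2)) ∧
    ∀ h ∈ H, (h.1 y.1 ≤ h.2 * y.2 → h.1 z.1 ≤ h.2 * z.2) ∧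
      (h.2 * y.2 ≤ h.1 y.1 → h.2 * z.2 ≤ h.1 z.1) := by
  simp only [cell, homogenization, Set.mem_ofPred_eq, Set.forall_mem_insert, Set.forall_mem_image]
  simp [← sub_eq_add_neg]

theorem cell_homogenization_smul {t : ℝ} (ht : 0 < t) (y : V × ℝ) :
    cell (homogenization H) (t • y) = cell (homogenization H) y := by
  ext z
  simp only [mem_cell_homogenization, Prod.smul_fst, Prod.smul_snd, map_smul, smul_eq_mul,
    mul_left_comm _ t, mul_le_mul_iff_right₀ ht, mul_nonneg_iff_of_pos_left ht,
    mul_nonpos_iff_pos_imp_nonpos]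
  simp [ht, ht.le]

theorem smul_mem_cell_homogenization_iff {t : ℝ} (ht : 0 < t) {u v : V} :
    t • (u, (1 : ℝ)) ∈ cell (homogenization H) (v, 1) ↔ u ∈ cell H v := by
  rw [mem_cell_homogenization]
  simp [cell, mul_comm _ t, ht, ht.le]

theorem cell_homogenization_zero (w : V) :
    cell (homogenization H) (w, 0) = cell (linearPart H) w ×ˢ ({0} : Set ℝ) := by
  ext ⟨u, t⟩
  simp only [mem_cell_homogenization, Set.mem_prod, mem_cell_linearPart, Set.mem_singleton_iff,
    mul_zero, le_refl, forall_const]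
  constructor
  · rintro ⟨ht, h⟩
    obtain rfl : t = 0 := le_antisymm ht.1 ht.2
    exact ⟨by simpa using h, rfl⟩
  · rintro ⟨h, rfl⟩
    simpa using h

theorem mem_cell_homogenization_one_of_zero {w v : V} :
    (w, (0 : ℝ)) ∈ cell (homogenization H) (v, 1) ↔ w ∈ recCone (cell H v) := by
  simp [mem_cell_homogenization, mem_recCone_cell]

/-! ### Face-closed families of cells and their recession -/

/-- The cells of an arrangement that meet `A` in their relative interior. -/
theorem isPolyhedralComplex_image_cell (hH : H.Finite) {A : Set V} (hne : A.Nonempty)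
    (hA : ∀ v ∈ A, cell H v ⊆ A) : IsPolyhedralComplex (cell H '' A) := by
  refine (isPolyhedralComplex_range_cell hH).mono (Set.image_subset_range _ _) (hne.image _) ?_
  rintro _ ⟨v, hv, rfl⟩ F hF
  obtain ⟨z, hz, rfl⟩ := hF.exists_eq_cell hH
  exact ⟨z, hA v hv hz, rfl⟩

theorem isPolyhedralComplex_recession (hH : H.Finite) {A : Set V} (hne : A.Nonempty)
    (hA : ∀ v ∈ A, cell H v ⊆ A) : IsPolyhedralComplex (recession (cell H '' A)) := by
  refine (isPolyhedralComplex_range_cell (H := linearPart H) (hH.image _)).mono ?_ ?_ ?_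
  · rintro _ ⟨_, ⟨v, -, rfl⟩, rfl⟩
    obtain ⟨z, -, hz⟩ := exists_recCone_cell_eq hH v
    exact ⟨z, hz.symm⟩
  · obtain ⟨v, hv⟩ := hne
    exact ⟨_, _, ⟨v, hv, rfl⟩, rfl⟩
  · rintro _ ⟨_, ⟨v, hv, rfl⟩, rfl⟩ F hF
    obtain ⟨z, -, hz⟩ := exists_recCone_cell_eq hH v
    rw [hz] at hF
    obtain ⟨w, hw, rfl⟩ := hF.exists_eq_cell (H := linearPart H) (hH.image _)
    rw [← hz] at hw
    obtain ⟨u, hu, hur⟩ := exists_recCone_eq_cell hH hw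
    exact ⟨_, ⟨u, hA v hv hu, rfl⟩, hur.symm⟩

end Arrangement

/-! ### Cones over cells -/

section Cone

variable {V : Type*} [AddCommGroup V] [Module ℝ V] [TopologicalSpace V] [IsTopologicalAddGroup V]
  [ContinuousSMul ℝ V] [T2Space V] [FiniteDimensional ℝ V] {H : Set (Module.Dual ℝ V × ℝ)}

theorem isClosed_cell (v : V) : IsClosed (cell H v) := by
  have : cell H v = ⋂ h ∈ H, ({u | h.1 v ≤ h.2 → h.1 u ≤ h.2} ∩ {u | h.2 ≤ h.1 v → h.2 ≤ h.1 u}) := by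
    ext u
    simp [cell]
  rw [this]
  refine isClosed_biInter fun h _ => ?_
  have hc : Continuous h.1 := h.1.continuous_of_finiteDimensional
  refine IsClosed.inter ?_ ?_ <;> simp only [Set.ofPred_forall]
  · exact isClosed_iInter fun _ => isClosed_le hc continuous_const
  · exact isClosed_iInter fun _ => isClosed_le continuous_const hc

/-- The cell is closed, which gives one inclusion. For the other, adding `ε • (v, 1)` to a point
keeps it in the cell and makes its height positive; it can then be rescaled to height one, and `ε`
tends to zero. -/
theorem coneOver_cell (v : V) : coneOver (cell H v) = cell (homogenization H) (v, 1) := by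
  refine Set.Subset.antisymm (closure_minimal ?_ (isClosed_cell _)) ?_
  · rintro _ ⟨t, ht, u, hu, rfl⟩
    exact (smul_mem_cell_homogenization_iff ht).2 hu
  · rintro ⟨z, s⟩ hz
    have hs : 0 ≤ s := (mem_cell_homogenization.1 hz).1.2 zero_le_one
    have hlim : Tendsto (fun ε : ℝ => ((z, s) + ε • (v, 1) : V × ℝ)) (𝓝[>] 0) (𝓝 (z, s)) := by
      refine Tendsto.mono_left ?_ nhdsWithin_le_nhds
      have : Continuous fun ε : ℝ => ((z, s) + ε • (v, 1) : V × ℝ) := by fun_prop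
      simpa using this.tendsto 0
    refine mem_closure_of_tendsto hlim ?_
    filter_upwards [self_mem_nhdsWithin] with ε hε
    have hε : 0 < ε := hε
    have hpos : 0 < s + ε := by linarith
    have heq : ((z, s) + ε • (v, 1) : V × ℝ) = (s + ε) • ((s + ε)⁻¹ • (z + ε • v), (1 : ℝ)) := by
      simp [smul_smul, hpos.ne']
    refine ⟨s + ε, hpos, _, ?_, heq⟩
    rw [← smul_mem_cell_homogenization_iff hpos, ← heq, mem_cell_homogenization]
    rw [mem_cell_homogenization] at hz
    refine ⟨by simp [hpos.le], fun h hh => ?_⟩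
    have h1 := hz.2 h hh
    simp only [mul_one, Prod.fst_add, Prod.snd_add, Prod.smul_fst, Prod.smul_snd, map_add,
      map_smul, smul_eq_mul] at h1 ⊢
    refine ⟨fun h2 => ?_, fun h2 => ?_⟩
    · linarith [h1.1 h2, mul_le_mul_of_nonneg_left h2 hε.le]
    · linarith [h1.2 h2, mul_le_mul_of_nonneg_left h2 hε.le]

theorem isPolyhedralComplex_coneComplex (hH : H.Finite) {A : Set V} (hne : A.Nonempty)
    (hA : ∀ v ∈ A, cell H v ⊆ A) : IsPolyhedralComplex (coneComplex (cell H '' A)) := by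
  have hzero : ∀ v ∈ A, ∀ w ∈ recCone (cell H v),
      cell (homogenization H) (w, 0) ∈ coneComplex (cell H '' A) := by
    intro v hv w hw
    obtain ⟨u, hu, hur⟩ := exists_recCone_eq_cell hH hw
    refine Or.inr ⟨_, ⟨_, ⟨u, hA v hv hu, rfl⟩, rfl⟩, ?_⟩
    rw [hur, cell_homogenization_zero]
  refine (isPolyhedralComplex_range_cell (finite_homogenization hH)).mono ?_ ?_ ?_
  · rintro _ (⟨_, ⟨v, -, rfl⟩, rfl⟩ | ⟨_, ⟨_, ⟨v, -, rfl⟩, rfl⟩, rfl⟩)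
    · exact ⟨(v, 1), (coneOver_cell v).symm⟩
    · obtain ⟨z, -, hz⟩ := exists_recCone_cell_eq hH v
      exact ⟨(z, 0), by rw [hz, cell_homogenization_zero]⟩
  · obtain ⟨v, hv⟩ := hne
    exact ⟨_, Or.inl ⟨_, ⟨v, hv, rfl⟩, rfl⟩⟩
  · rintro _ (⟨_, ⟨v, hv, rfl⟩, rfl⟩ | ⟨_, ⟨_, ⟨v, hv, rfl⟩, rfl⟩, rfl⟩) F hF
    · rw [coneOver_cell] at hF
      obtain ⟨⟨z, s⟩, hz, rfl⟩ := hF.exists_eq_cell (finite_homogenization hH)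
      have hs : 0 ≤ s := (mem_cell_homogenization.1 hz).1.2 zero_le_one
      -- A face is the cell of a point at height `s`. At `s = 0` that point is a recession
      -- direction; for `s > 0`, rescaling to height one gives the cone over a face of `cell H v`.
      rcases hs.eq_or_lt with rfl | hs
      · exact hzero v hv z (mem_cell_homogenization_one_of_zero.1 hz)
      · have heq : (z, s) = s • (s⁻¹ • z, (1 : ℝ)) := by simp [smul_smul, hs.ne']
        rw [heq, smul_mem_cell_homogenization_iff hs] at hz
        rw [heq, cell_homogenization_smul hs, ← coneOver_cell]
        exact Or.inl ⟨_, ⟨_, hA v hv hz, rfl⟩, rfl⟩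
    · obtain ⟨y, -, hy⟩ := exists_recCone_cell_eq hH v
      rw [hy, ← cell_homogenization_zero] at hF
      obtain ⟨⟨w, s⟩, hw, rfl⟩ := hF.exists_eq_cell (finite_homogenization hH)
      rw [cell_homogenization_zero, ← hy] at hw
      obtain ⟨hw, rfl : s = 0⟩ := hw
      exact hzero v hv w hw

end Cone

/-! ### The arrangement of a complex and the conclusion -/

/-- The halfspaces of finitely many polyhedra form a finite arrangement such that the cells at
points of a polyhedron are contained in it. -/
theorem exists_arrangement {V : Type*} [AddCommGroup V] [Module ℝ V] {S : Set (Set V)}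
    (hS : S.Finite) (hP : ∀ P ∈ S, IsPolyhedron P) :
    ∃ H : Set (Module.Dual ℝ V × ℝ), H.Finite ∧ ∀ P ∈ S, ∀ v ∈ P, cell H v ⊆ P := by
  choose! G hfin hG using hP
  refine ⟨⋃ P ∈ S, G P, hS.biUnion hfin, fun P hPS v hv u hu => ?_⟩
  rw [hG P hPS] at hv ⊢
  exact fun h hh => (hu h (Set.mem_biUnion hPS hh)).1 (hv h hh)

end PolyComplex

theorem proposition3p14 (n : ℕ) (S : Set (Set (EuclideanSpace ℝ (Fin n))))
    (hS : PolyComplex.IsPolyhedralComplex S) :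
    ∃ S' : Set (Set (EuclideanSpace ℝ (Fin n))),
      PolyComplex.IsSubdivision S' S ∧ PolyComplex.IsExtendable S' ∧
      PolyComplex.IsPolyhedralComplex (PolyComplex.recession S') ∧
      PolyComplex.IsPolyhedralComplex (PolyComplex.coneComplex S') := by
  obtain ⟨H, hH, hcell⟩ := PolyComplex.exists_arrangement hS.finite hS.isPolyhedron
  have hA : ∀ v ∈ PolyComplex.support S, PolyComplex.cell H v ⊆ PolyComplex.support S :=
    fun v ⟨P, hP, hv⟩ u hu => ⟨P, hP, hcell P hP v hv hu⟩
  have hne : (PolyComplex.support S).Nonempty := by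
    obtain ⟨P, hP⟩ := hS.nonempty
    obtain ⟨v, hv⟩ := hS.nonempty_of_mem P hP
    exact ⟨v, P, hP, hv⟩
  have hcx := PolyComplex.isPolyhedralComplex_image_cell hH hne hA
  refine ⟨PolyComplex.cell H '' PolyComplex.support S, ⟨hcx, ?_, ?_⟩,
    ⟨hcx, _, PolyComplex.isPolyhedralComplex_range_cell hH, PolyComplex.support_range_cell,
      Set.image_subset_range _ _⟩,
    PolyComplex.isPolyhedralComplex_recession hH hne hA,
    PolyComplex.isPolyhedralComplex_coneComplex hH hne hA⟩
  · ext u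
    constructor
    · rintro ⟨_, ⟨v, hv, rfl⟩, hu⟩
      exact hA v hv hu
    · exact fun hu => ⟨_, ⟨u, hu, rfl⟩, PolyComplex.self_mem_cell u⟩
  · rintro _ ⟨v, ⟨P, hP, hv⟩, rfl⟩
    exact ⟨P, hP, hcell P hP v hv⟩
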